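/- Let $\mathbb T=\{-\infty\}\cup\mathbb R\cup\mathbb R^\nu$ be the extended tropical semiring, where $\mathbb R^\nu=\{a^\nu : a\in\mathbb R\}$ is a second, disjoint copy of $\mathbb R$ (the ghost elements). It is totally ordered by $\prec$: $-\infty$ is the least element; if $a<b$ in $\mathbb R$, then each of $a,a^\nu$ is $\prec$ each of $b,b^\nu$; and $a\prec a^\nu$ for all $a\in\mathbb R$. Addition is $x\oplus y=\max_{\prec}\{x,y\}$ if $x\neq y$, $a\oplus a=a^\nu\oplus a^\nu=a^\nu$ for $a\in\mathbb R$, and $(-\infty)\oplus(-\infty)=-\infty$. Multiplication is $a\odot b=a+b$, $a^\nu\odot b=a\odot b^\nu=a^\nu\odot b^\nu=(a+b)^\nu$ for $a,b\in\mathbb R$, and $(-\infty)\odot x=x\odot(-\infty)=-\infty$. Put $\bar{\mathbb R}=\mathbb R\cup\{-\infty\}$ and $\bar{\mathbb U}=\mathbb R^\nu\cup\{-\infty\}$. A finite family of vectors $v_1,\dots,v_p\in\mathbb T^{(n)}$ is tropically dependent if there are $\alpha_1,\dots,\alpha_p\in\bar{\mathbb R}$, not all $-\infty$, with $\alpha_1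 v_1\oplus\cdots\oplus\alpha_p v_p\in\bar{\mathbb U}^{(n)}$, and tropically independent otherwise (the empty family is independent). The tropical rank $\operatorname{rk}(A)$ of an $m\times n$ matrix $A$ over $\mathbb T$ is the maximal number of tropically independent rows of $A$. An $s\times s$ matrix $B=(b_{i,j})$ over $\mathbb T$ is nonsingular if its tropical determinant $|B|=\bigoplus_{\sigma\in S_s} b_{1,\sigma(1)}\odot\cdots\odot b_{s,\sigma(s)}$ does not lie in $\bar{\mathbb U}$; the empty $0\times 0$ matrix has determinant $0$, the unit of $\mathbb T$, and so is nonsingular. An $s\times s$ minor of $A$ is the square submatrix formed by some $s$ rows and some $s$ columns of $A$. Corollary. Let $A$ be an $m\times n$ matrix over $\mathbb T$ and let $k\ge 0$ be an integer. Then $\operatorname{rk}(A)=k$ if and only if $k$ is the largest $s$ for which $A$ has a nonsingular $s\times s$ minor. -/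

import Mathlib

/-- The extended tropical semiring `𝕋 = (ℝ ∪ {-∞}) ∪ (ℝ^ν ∪ {-∞})`: two copies of the reals (the real
elements `a` and the ghost elements `a^ν`), glued along a common element `-∞`. -/
inductive ExtTrop : Type
  | negInf : ExtTrop
  | real : ℝ → ExtTrop
  | ghost : ℝ → ExtTrop

namespace ExtTrop

/-- The pair (underlying real value, ghost flag), or `⊥` for `-∞`. -/
def key : ExtTrop → WithBot (ℝ ×ₗ Bool)
  | negInf => ⊥
  | real a => ((toLex (a, false) : ℝ ×ₗ Bool) : WithBot (ℝ ×ₗ Bool))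
  | ghost a => ((toLex (a, true) : ℝ ×ₗ Bool) : WithBot (ℝ ×ₗ Bool))

theorem key_injective : Function.Injective key := by
  intro x y h
  cases x <;> cases y <;> simp_all [key]

/-- The total order `≺`: `-∞` is the least element, elements with different underlying real values
are compared by these values, and `a ≺ a^ν`. -/
noncomputable instance : LinearOrder ExtTrop := LinearOrder.lift' key key_injective

theorem le_iff_key {x y : ExtTrop} : x ≤ y ↔ key x ≤ key y := Iff.rfl

theorem negInf_le (x : ExtTrop) : negInf ≤ x := by
  simp [le_iff_key, key]

theorem not_real_le_negInf (a : ℝ) : ¬ real a ≤ negInf := by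
  simp [le_iff_key, key]

theorem not_ghost_le_negInf (a : ℝ) : ¬ ghost a ≤ negInf := by
  simp [le_iff_key, key]

theorem real_le_real {a b : ℝ} : real a ≤ real b ↔ a ≤ b := by
  rw [le_iff_lt_or_eq (a := a), le_iff_key]
  simp [key, Prod.Lex.toLex_le_toLex]

theorem real_le_ghost {a b : ℝ} : real a ≤ ghost b ↔ a ≤ b := by
  rw [le_iff_lt_or_eq (a := a), le_iff_key]
  simp [key, Prod.Lex.toLex_le_toLex]

theorem ghost_le_real {a b : ℝ} : ghost a ≤ real b ↔ a < b := by
  simp [le_iff_key, key, Prod.Lex.toLex_le_toLex]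

theorem ghost_le_ghost {a b : ℝ} : ghost a ≤ ghost b ↔ a ≤ b := by
  rw [le_iff_lt_or_eq (a := a), le_iff_key]
  simp [key, Prod.Lex.toLex_le_toLex]

/-- The ghost map `ν`. -/
def nu : ExtTrop → ExtTrop
  | negInf => negInf
  | real a => ghost a
  | ghost a => ghost a

/-- `x ⊕ y` is the maximum of `x` and `y` if `x ≠ y`, and `x ⊕ x = x^ν`
(in particular `-∞ ⊕ -∞ = -∞`). -/
noncomputable instance : Add ExtTrop := ⟨fun x y => if x = y then nu x else max x y⟩

/-- `x ⊙ y` adds the underlying real values; the result is real exactly if both factors are,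
and `-∞` is absorbing. -/
noncomputable instance : Mul ExtTrop := ⟨fun x y =>
  match x, y with
  | negInf, _ => negInf
  | _, negInf => negInf
  | real a, real b => real (a + b)
  | real a, ghost b => ghost (a + b)
  | ghost a, real b => ghost (a + b)
  | ghost a, ghost b => ghost (a + b)⟩

instance : Zero ExtTrop := ⟨negInf⟩

noncomputable instance : One ExtTrop := ⟨real 0⟩

theorem add_def (x y : ExtTrop) : x + y = if x = y then nu x else max x y := rfl
theorem zero_def : (0 : ExtTrop) = negInf := rfl
theorem one_def : (1 : ExtTrop) = real 0 := rfl
theorem negInf_mul (x : ExtTrop) : negInf * x = negInf := by cases x <;> rfl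
theorem mul_negInf (x : ExtTrop) : x * negInf = negInf := by cases x <;> rfl
theorem real_mul_real (a b : ℝ) : real a * real b = real (a + b) := rfl
theorem real_mul_ghost (a b : ℝ) : real a * ghost b = ghost (a + b) := rfl
theorem ghost_mul_real (a b : ℝ) : ghost a * real b = ghost (a + b) := rfl
theorem ghost_mul_ghost (a b : ℝ) : ghost a * ghost b = ghost (a + b) := rfl

theorem negInf_add (x : ExtTrop) : negInf + x = x := by
  cases x <;> simp [add_def, nu, negInf_le]

theorem add_negInf (x : ExtTrop) : x + negInf = x := by
  cases x <;> simp [add_def, nu, negInf_le]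

theorem real_add_real (a b : ℝ) :
    real a + real b = if a < b then real b else if b < a then real a else ghost a := by
  simp only [add_def, nu, max_def, real_le_real, real.injEq]
  grind

theorem real_add_ghost (a b : ℝ) :
    real a + ghost b = if b < a then real a else ghost b := by
  simp only [add_def, nu, max_def, real_le_ghost, reduceCtorEq]
  grind

theorem ghost_add_real (a b : ℝ) :
    ghost a + real b = if a < b then real b else ghost a := by
  simp only [add_def, nu, max_def, ghost_le_real, reduceCtorEq]
  grind

theorem ghost_add_ghost (a b : ℝ) :
    ghost a + ghost b = if a < b then ghost b else ghost a := by
  simp only [add_def, nu, max_def, ghost_le_ghost, ghost.injEq]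
  grind

protected theorem add_comm' (x y : ExtTrop) : x + y = y + x := by
  cases x <;> cases y <;>
    simp only [negInf_add, add_negInf, real_add_real, real_add_ghost, ghost_add_real,
      ghost_add_ghost] <;> grind

protected theorem mul_comm' (x y : ExtTrop) : x * y = y * x := by
  cases x <;> cases y <;>
    simp only [negInf_mul, mul_negInf, real_mul_real, real_mul_ghost, ghost_mul_real,
      ghost_mul_ghost, add_comm]

protected theorem add_assoc' (x y z : ExtTrop) : x + y + z = x + (y + z) := by
  cases x <;> cases y <;> cases z <;>
    simp only [negInf_add, add_negInf, real_add_real, real_add_ghost, ghost_add_real,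
      ghost_add_ghost] <;>
    split_ifs <;>
    simp only [real_add_real, real_add_ghost, ghost_add_real, ghost_add_ghost] <;> grind

protected theorem mul_assoc' (x y z : ExtTrop) : x * y * z = x * (y * z) := by
  cases x <;> cases y <;> cases z <;>
    simp only [negInf_mul, mul_negInf, real_mul_real, real_mul_ghost, ghost_mul_real,
      ghost_mul_ghost, add_assoc]

protected theorem mul_add' (x y z : ExtTrop) : x * (y + z) = x * y + x * z := by
  cases x <;> cases y <;> cases z <;>
    simp only [negInf_add, add_negInf, real_add_real, real_add_ghost, ghost_add_real,
      ghost_add_ghost, negInf_mul, mul_negInf, real_mul_real, real_mul_ghost, ghost_mul_real,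
      ghost_mul_ghost, add_lt_add_iff_left] <;>
    split_ifs <;> (first | rfl | grind [real_mul_real, real_mul_ghost, ghost_mul_real, ghost_mul_ghost])

noncomputable instance : CommSemiring ExtTrop where
  add_assoc := ExtTrop.add_assoc'
  zero_add := negInf_add
  add_zero := add_negInf
  add_comm := ExtTrop.add_comm'
  nsmul := nsmulRec
  left_distrib := ExtTrop.mul_add'
  right_distrib x y z := by
    rw [ExtTrop.mul_comm' (x + y) z, ExtTrop.mul_add', ExtTrop.mul_comm' z x,
      ExtTrop.mul_comm' z y]
  zero_mul := negInf_mul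
  mul_zero := mul_negInf
  mul_assoc := ExtTrop.mul_assoc'
  one_mul x := by
    cases x <;> simp [one_def, mul_negInf, real_mul_real, real_mul_ghost]
  mul_one x := by
    cases x <;> simp [one_def, negInf_mul, real_mul_real, ghost_mul_real]
  mul_comm := ExtTrop.mul_comm'

/-- `ℝ ∪ {-∞}`. -/
def realBar : Set ExtTrop := {x | x = negInf ∨ ∃ a : ℝ, x = real a}

/-- `ℝ^ν ∪ {-∞}`. -/
def ghostBar : Set ExtTrop := {x | x = negInf ∨ ∃ a : ℝ, x = ghost a}

/-- A vector is a ghost vector if all of its entries are ghosts or `-∞`. -/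
def IsGhostVector {n : ℕ} (v : Fin n → ExtTrop) : Prop := ∀ j, v j ∈ ghostBar

/-- A finite family of vectors is tropically dependent if some combination of it, with coefficients in
`ℝ ∪ {-∞}` that are not all `-∞`, is a ghost vector. -/
def TropDependent {ι : Type} [Fintype ι] {n : ℕ} (v : ι → Fin n → ExtTrop) : Prop :=
  ∃ α : ι → ExtTrop, (∀ i, α i ∈ realBar) ∧ (∃ i, α i ≠ negInf) ∧
    IsGhostVector (∑ i, α i • v i)

def TropIndependent {ι : Type} [Fintype ι] {n : ℕ} (v : ι → Fin n → ExtTrop) : Prop :=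
  ¬ TropDependent v

open Classical in
/-- The tropical rank: the maximal number of tropically independent rows, i.e. the maximal cardinality of
a set `S` of row indices for which the family of rows indexed by `S` is tropically independent. -/
noncomputable def tropRank {m n : ℕ} (A : Matrix (Fin m) (Fin n) ExtTrop) : ℕ :=
  (Finset.univ.filter fun S : Finset (Fin m) => TropIndependent fun i : S => A i).sup Finset.card

/-- The tropical determinant `⨁_σ a_{1,σ(1)} ⊙ ⋯ ⊙ a_{n,σ(n)}`. -/
noncomputable def tropDet {n : ℕ} (A : Matrix (Fin n) (Fin n) ExtTrop) : ExtTrop :=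
  ∑ σ : Equiv.Perm (Fin n), ∏ i, A i (σ i)

def TropSingular {n : ℕ} (A : Matrix (Fin n) (Fin n) ExtTrop) : Prop := tropDet A ∈ ghostBar

def TropNonsingular {n : ℕ} (A : Matrix (Fin n) (Fin n) ExtTrop) : Prop := ¬ TropSingular A

/-- `A` has a nonsingular `s × s` minor: the square submatrix formed by some `s` rows and some `s`
columns of `A` (in increasing order) is tropically nonsingular. -/
def HasNonsingularMinor {m n : ℕ} (A : Matrix (Fin m) (Fin n) ExtTrop) (s : ℕ) : Prop :=
  ∃ (r : Fin s ↪o Fin m) (c : Fin s ↪o Fin n), TropNonsingular (A.submatrix r c)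

end ExtTrop

/-! Both sides reduce to one combinatorial condition, `IsDominant`: distinct columns can be assigned
to the chosen rows through tangible entries so that every nontrivial permutation of the rows has
strictly smaller total weight. For a square minor this is nonsingularity, since by `isReal_sum` a
sum is tangible iff one tangible term strictly dominates.

It is also equivalent to independence of the rows. Given a dependence and a dominant assignment,
each supporting row is balanced by another one; following these choices closes a cycle, and
permuting along it loses no weight, a contradiction (`IsDominant.tropIndependent`). Conversely,
`exists_balances` builds a dependence by induction on the set of tangible entries to be balanced;
when these form an injective assignment, a competing permutation yields the coefficients through
`exists_potential`. -/

namespace ExtTrop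

open Finset

/-! ### Magnitudes and tangible elements. -/

/-- The underlying real value, forgetting whether an element is a ghost. -/
def magnitude : ExtTrop → WithBot ℝ
  | negInf => ⊥
  | real a => (a : WithBot ℝ)
  | ghost a => (a : WithBot ℝ)

/-- The tangible elements, i.e. those outside `ghostBar`. -/
def IsReal (x : ExtTrop) : Prop := ∃ a : ℝ, x = real a

/-- The tangible element (or `-∞`) of given magnitude. -/
def ofMagnitude : WithBot ℝ → ExtTrop
  | ⊥ => negInf
  | (a : ℝ) => real a

theorem magnitude_ofMagnitude (x : WithBot ℝ) : magnitude (ofMagnitude x) = x := by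
  cases x <;> rfl

theorem ofMagnitude_mem_realBar (x : WithBot ℝ) : ofMagnitude x ∈ realBar := by
  cases x with
  | bot => exact Or.inl rfl
  | coe a => exact Or.inr ⟨a, rfl⟩

theorem magnitude_eq_bot {x : ExtTrop} : magnitude x = ⊥ ↔ x = negInf := by
  cases x <;> simp [magnitude]

theorem IsReal.magnitude_ne_bot {x : ExtTrop} (h : IsReal x) : magnitude x ≠ ⊥ := by
  obtain ⟨a, rfl⟩ := h
  simp [magnitude]

theorem notMem_ghostBar {x : ExtTrop} : x ∉ ghostBar ↔ IsReal x := by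
  cases x <;> simp [ghostBar, IsReal]

theorem magnitude_add (x y : ExtTrop) : magnitude (x + y) = max (magnitude x) (magnitude y) := by
  cases x <;> cases y <;>
    simp only [negInf_add, add_negInf, real_add_real, real_add_ghost, ghost_add_real,
      ghost_add_ghost] <;> (try split_ifs) <;> simp [magnitude] <;> grind

theorem magnitude_mul (x y : ExtTrop) : magnitude (x * y) = magnitude x + magnitude y := by
  cases x <;> cases y <;> rfl

theorem isReal_mul {x y : ExtTrop} : IsReal (x * y) ↔ IsReal x ∧ IsReal y := by
  cases x <;> cases y <;>
    simp [negInf_mul, mul_negInf, real_mul_real, real_mul_ghost, ghost_mul_real,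
      ghost_mul_ghost, IsReal]

theorem isReal_add {x y : ExtTrop} : IsReal (x + y) ↔
    IsReal x ∧ magnitude y < magnitude x ∨ IsReal y ∧ magnitude x < magnitude y := by
  cases x <;> cases y <;>
    simp only [negInf_add, add_negInf, real_add_real, real_add_ghost, ghost_add_real,
      ghost_add_ghost] <;> (try split_ifs) <;> simp [IsReal, magnitude] <;> grind

theorem magnitude_prod {ι : Type*} (s : Finset ι) (f : ι → ExtTrop) :
    magnitude (∏ i ∈ s, f i) = ∑ i ∈ s, magnitude (f i) := by
  classical
  induction s using Finset.induction_on with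
  | empty => rfl
  | insert i s hi ih => rw [prod_insert hi, sum_insert hi, magnitude_mul, ih]

theorem isReal_prod {ι : Type*} (s : Finset ι) (f : ι → ExtTrop) :
    IsReal (∏ i ∈ s, f i) ↔ ∀ i ∈ s, IsReal (f i) := by
  classical
  induction s using Finset.induction_on with
  | empty => simp [IsReal, one_def]
  | insert i s hi ih => rw [prod_insert hi, isReal_mul, ih, forall_mem_insert]

theorem magnitude_sum_lt {ι : Type*} (s : Finset ι) (f : ι → ExtTrop) {x : WithBot ℝ}
    (hx : ⊥ < x) : magnitude (∑ i ∈ s, f i) < x ↔ ∀ i ∈ s, magnitude (f i) < x := by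
  classical
  induction s using Finset.induction_on with
  | empty => simpa [zero_def, magnitude] using hx
  | insert i s hi ih => rw [sum_insert hi, magnitude_add, max_lt_iff, ih, forall_mem_insert]

theorem magnitude_le_sum {ι : Type*} {s : Finset ι} (f : ι → ExtTrop) {i : ι} (hi : i ∈ s) :
    magnitude (f i) ≤ magnitude (∑ i ∈ s, f i) := by
  classical
  rw [← add_sum_erase _ _ hi, magnitude_add]
  exact le_max_left _ _

/-- A sum is tangible iff it has a strictly dominant summand, which is tangible. -/
theorem isReal_sum {ι : Type*} (s : Finset ι) (f : ι → ExtTrop) :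
    IsReal (∑ i ∈ s, f i) ↔
      ∃ i ∈ s, IsReal (f i) ∧ ∀ j ∈ s, j ≠ i → magnitude (f j) < magnitude (f i) := by
  classical
  constructor
  · induction s using Finset.induction_on with
    | empty => simp [IsReal, zero_def]
    | insert i s hi ih =>
      rw [sum_insert hi, isReal_add]
      rintro (⟨h, hlt⟩ | ⟨h, hlt⟩)
      · refine ⟨i, mem_insert_self _ _, h, fun j hj hji => ?_⟩
        exact (magnitude_le_sum f ((mem_insert.1 hj).resolve_left hji)).trans_lt hlt
      · obtain ⟨k, hk, hr, hd⟩ := ih h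
        refine ⟨k, mem_insert_of_mem hk, hr, fun j hj hjk => ?_⟩
        rcases mem_insert.1 hj with rfl | hj
        · by_contra! hle
          refine lt_irrefl _ ((magnitude_sum_lt s f (bot_le.trans_lt hlt)).2 fun l hl => ?_)
          rcases eq_or_ne l k with rfl | hlk
          · exact hle.trans_lt hlt
          · exact ((hd l hl hlk).trans_le hle).trans hlt
        · exact hd j hj hjk
  · rintro ⟨i, hi, hr, hd⟩
    rw [← add_sum_erase _ _ hi, isReal_add]
    refine Or.inl ⟨hr, (magnitude_sum_lt _ _ (bot_lt_iff_ne_bot.2 hr.magnitude_ne_bot)).2 ?_⟩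
    exact fun j hj => hd j (mem_of_mem_erase hj) (ne_of_mem_erase hj)

/-! ### Dependence and minors in terms of magnitudes. -/

/-- `α` balances the entry `(i, j)` of a matrix of magnitudes: in the combination of the rows with
coefficients `α`, row `i` is not the only one attaining the maximum of column `j`. -/
def Balances {ι κ : Type*} (m : ι → κ → WithBot ℝ) (α : ι → WithBot ℝ) (i : ι) (j : κ) : Prop :=
  ∃ i', i' ≠ i ∧ α i + m i j ≤ α i' + m i' j

/-- By `isReal_sum`, a column fails to be ghost only through a tangible term exceeding all others,
so only tangible entries in supporting rows need balancing, and coefficients matter only through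
their magnitudes. -/
theorem tropDependent_iff {ι : Type} [Fintype ι] {n : ℕ} (v : ι → Fin n → ExtTrop) :
    TropDependent v ↔ ∃ α : ι → WithBot ℝ, (∃ i, α i ≠ ⊥) ∧
      ∀ i j, α i ≠ ⊥ → IsReal (v i j) → Balances (fun i j => magnitude (v i j)) α i j := by
  have key (α : ι → ExtTrop) (hα : ∀ i, α i ∈ realBar) : IsGhostVector (∑ i, α i • v i) ↔
      ∀ i j, magnitude (α i) ≠ ⊥ → IsReal (v i j) →
        Balances (fun i j => magnitude (v i j)) (fun i => magnitude (α i)) i j := by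
    rw [forall_comm]
    refine forall_congr' fun j => ?_
    rw [← not_iff_not, notMem_ghostBar, Finset.sum_apply, isReal_sum]
    simp only [Pi.smul_apply, smul_eq_mul, mem_univ, true_and, forall_const, isReal_mul,
      magnitude_mul, Balances]
    push Not
    refine exists_congr fun i => ?_
    have : IsReal (α i) ↔ magnitude (α i) ≠ ⊥ := by
      rcases hα i with h | ⟨a, h⟩ <;> simp [h, IsReal, magnitude]
    rw [this, and_assoc]
  constructor
  · rintro ⟨α, hα, ⟨i, hi⟩, h⟩
    exact ⟨fun i => magnitude (α i), ⟨i, magnitude_eq_bot.not.2 hi⟩, (key α hα).1 h⟩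
  · rintro ⟨α, ⟨i, hi⟩, h⟩
    refine ⟨fun i => ofMagnitude (α i), fun i => ofMagnitude_mem_realBar _, ⟨i, ?_⟩,
      (key _ fun i => ofMagnitude_mem_realBar _).2 ?_⟩
    · rwa [Ne, ← magnitude_eq_bot, magnitude_ofMagnitude]
    · simpa only [magnitude_ofMagnitude] using h

theorem tropNonsingular_iff {n : ℕ} (B : Matrix (Fin n) (Fin n) ExtTrop) :
    TropNonsingular B ↔ ∃ τ : Equiv.Perm (Fin n), (∀ i, IsReal (B i (τ i))) ∧
      ∀ σ, σ ≠ τ → ∑ i, magnitude (B i (σ i)) < ∑ i, magnitude (B i (τ i)) := by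
  rw [TropNonsingular, TropSingular, notMem_ghostBar, tropDet, isReal_sum]
  simp only [mem_univ, true_and, isReal_prod, magnitude_prod, forall_const]

/-- `φ` is a strictly dominant assignment of columns to the rows of `v`, through tangible entries. -/
structure IsDominant {ι κ : Type*} [Fintype ι] (v : ι → κ → ExtTrop) (φ : ι → κ) : Prop where
  injective : Function.Injective φ
  isReal : ∀ i, IsReal (v i (φ i))
  lt : ∀ σ : Equiv.Perm ι, σ ≠ 1 →
    ∑ i, magnitude (v (σ i) (φ i)) < ∑ i, magnitude (v i (φ i))

/-- Translates between the determinant, which permutes columns, and `IsDominant`, which permutes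
rows. -/
theorem sum_perm_cols {n : ℕ} {κ : Type*} (v : Fin n → κ → ExtTrop) (c : Fin n → κ)
    (σ τ : Equiv.Perm (Fin n)) :
    ∑ i, magnitude (v ((σ⁻¹ * τ) i) (c (τ i))) = ∑ i, magnitude (v i (c (σ i))) := by
  rw [← Equiv.sum_comp (σ⁻¹ * τ) fun i => magnitude (v i (c (σ i)))]
  simp

theorem tropNonsingular_iff_isDominant {n : ℕ} {κ : Type*} (v : Fin n → κ → ExtTrop)
    {c : Fin n → κ} (hc : Function.Injective c) :
    TropNonsingular (Matrix.of fun i j => v i (c j)) ↔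
      ∃ τ : Equiv.Perm (Fin n), IsDominant v (c ∘ τ) := by
  rw [tropNonsingular_iff]
  refine exists_congr fun τ => ⟨fun ⟨hr, hlt⟩ => ⟨hc.comp τ.injective, hr, fun σ hσ => ?_⟩,
    fun h => ⟨h.isReal, fun σ hσ => ?_⟩⟩
  · have := hlt (τ * σ⁻¹) (by simpa using hσ)
    simp only [Matrix.of_apply] at this
    rw [← sum_perm_cols v c (τ * σ⁻¹) τ] at this
    simpa only [mul_inv_rev, inv_inv, inv_mul_cancel_right, Matrix.of_apply, Function.comp_apply,
      mul_inv_cancel_right, inv_mul_cancel, mul_one, mul_assoc] using this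
  · have := h.lt (σ⁻¹ * τ) (by rw [Ne, inv_mul_eq_one]; exact hσ)
    simpa only [Function.comp_apply, sum_perm_cols, Matrix.of_apply] using this

theorem hasNonsingularMinor_iff {m n : ℕ} (A : Matrix (Fin m) (Fin n) ExtTrop) (s : ℕ) :
    HasNonsingularMinor A s ↔
      ∃ (r : Fin s ↪o Fin m) (φ : Fin s → Fin n), IsDominant (fun i => A (r i)) φ := by
  refine exists_congr fun r => ⟨fun ⟨c, h⟩ => ?_, fun ⟨φ, h⟩ => ?_⟩
  · obtain ⟨τ, h⟩ := (tropNonsingular_iff_isDominant (fun i => A (r i)) c.injective).1 h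
    exact ⟨_, h⟩
  · have hcard : (univ.image φ).card = s := by
      rw [card_image_of_injective _ h.injective, card_univ, Fintype.card_fin]
    -- A minor lists its columns in increasing order; the order in which `φ` visits them is absorbed
    -- by the permutation `τ`.
    let c := (univ.image φ).orderEmbOfFin hcard
    have hτ (i : Fin s) : ∃ k, c k = φ i := by
      have : φ i ∈ Set.range c := by simp [c]
      exact this
    choose τ hτ using hτ
    have hinj : Function.Injective τ := fun i k hik => h.injective (by rw [← hτ, ← hτ, hik])
    refine ⟨c, (tropNonsingular_iff_isDominant (fun i => A (r i)) c.injective).2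
      ⟨Equiv.ofBijective τ (Finite.injective_iff_bijective.1 hinj), ?_⟩⟩
    convert h
    exact funext hτ

/-! ### Dominance implies independence. -/

theorem sum_coe_withBot {ι : Type*} (s : Finset ι) (f : ι → ℝ) :
    ∑ i ∈ s, (f i : WithBot ℝ) = ((∑ i ∈ s, f i : ℝ) : WithBot ℝ) :=
  (map_sum (⟨⟨WithBot.some, rfl⟩, fun _ _ => rfl⟩ : ℝ →+ WithBot ℝ) f s).symm

/-- A dominant assignment forbids dependence: following, from each row in the support, a row that
balances it leads to a cycle, hence to another optimal assignment. -/
theorem IsDominant.tropIndependent {ι : Type} [Fintype ι] {n : ℕ} {v : ι → Fin n → ExtTrop}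
    {φ : ι → Fin n} (h : IsDominant v φ) : TropIndependent v := by
  classical
  intro hdep
  obtain ⟨α, ⟨i₀, hi₀⟩, hα⟩ := (tropDependent_iff v).1 hdep
  have hg (i : {i // α i ≠ ⊥}) : ∃ k : {i // α i ≠ ⊥}, k ≠ i ∧
      α i + magnitude (v i (φ i)) ≤ α k + magnitude (v k (φ i)) := by
    obtain ⟨k, hk, hle⟩ := hα i (φ i) i.2 (h.isReal i)
    -- The balancing row is again in the support, because the balanced term is finite.
    refine ⟨⟨k, fun hbot => ?_⟩, fun hki => hk (congrArg Subtype.val hki), hle⟩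
    simp only [hbot, WithBot.bot_add, le_bot_iff, WithBot.add_eq_bot] at hle
    exact hle.elim i.2 (h.isReal i).magnitude_ne_bot
  choose g hgne hg using hg
  let P := Function.periodicPts g
  -- `g` need not be injective, but it permutes its periodic points; fixing all other rows gives a
  -- permutation.
  let π (i : {i // α i ≠ ⊥}) : {i // α i ≠ ⊥} := if i ∈ P then g i else i
  have hbij := Function.bijOn_periodicPts g
  have hπ : Function.Injective π := by
    intro i k hik
    by_cases hi : i ∈ P <;> by_cases hk : k ∈ P <;> simp only [π, hi, hk, if_true, if_false] at hik
    · exact hbij.injOn hi hk hik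
    · exact absurd (hik ▸ hbij.mapsTo hi) hk
    · exact absurd (hik ▸ hbij.mapsTo hk) hi
    · exact hik
  let ρ : Equiv.Perm {i // α i ≠ ⊥} := Equiv.ofBijective π (Finite.injective_iff_bijective.1 hπ)
  let σ : Equiv.Perm ι := Equiv.Perm.ofSubtype ρ
  have hσ : σ ≠ 1 := by
    intro hσ1
    obtain ⟨i, hi⟩ : P.Nonempty := by
      have hrep : ∃ a b : ℕ, a < b ∧ g^[a] ⟨i₀, hi₀⟩ = g^[b] ⟨i₀, hi₀⟩ := by
        obtain ⟨a, b, hab, heq⟩ :=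
          Finite.exists_ne_map_eq_of_infinite fun k : ℕ => g^[k] ⟨i₀, hi₀⟩
        exact hab.lt_or_gt.elim (fun h => ⟨a, b, h, heq⟩) fun h => ⟨b, a, h, heq.symm⟩
      obtain ⟨a, b, hab, heq⟩ := hrep
      refine ⟨g^[a] ⟨i₀, hi₀⟩, Function.mk_mem_periodicPts (Nat.sub_pos_of_lt hab) ?_⟩
      rw [Function.IsPeriodicPt, Function.IsFixedPt, ← Function.iterate_add_apply,
        Nat.sub_add_cancel hab.le, heq]
    have h1 : ρ i = i := by
      have : ρ = 1 := Equiv.Perm.ofSubtype_injective (by rw [map_one]; exact hσ1)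
      rw [this]; rfl
    have h2 : ρ i = g i := if_pos hi
    exact hgne i (h2 ▸ h1)
  have hle (i : ι) (hi : α i ≠ ⊥) : α i + magnitude (v i (φ i)) ≤ α (σ i) + magnitude (v (σ i) (φ i)) := by
    have : σ i = ρ ⟨i, hi⟩ := Equiv.Perm.ofSubtype_apply_of_mem ρ hi
    rw [this]
    by_cases hP : (⟨i, hi⟩ : {i // α i ≠ ⊥}) ∈ P
    · have : ρ ⟨i, hi⟩ = g ⟨i, hi⟩ := if_pos hP
      rw [this]
      exact hg ⟨i, hi⟩
    · have : ρ ⟨i, hi⟩ = ⟨i, hi⟩ := if_neg hP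
      rw [this]
  -- Rows outside the support are fixed by `σ`, so their coefficient can be reset to `0`; all
  -- coefficients are then finite and cancel after summation.
  let β (i : ι) : ℝ := (α i).unbotD 0
  have hβ (i : ι) : (β i : WithBot ℝ) + magnitude (v i (φ i)) ≤
      (β (σ i) : WithBot ℝ) + magnitude (v (σ i) (φ i)) := by
    by_cases hi : α i = ⊥
    · have : σ i = i := Equiv.Perm.ofSubtype_apply_of_not_mem ρ (by simpa using hi)
      rw [this]
    · have hσi : α (σ i) ≠ ⊥ := by
        have : σ i = ρ ⟨i, hi⟩ := Equiv.Perm.ofSubtype_apply_of_mem ρ hi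
        rw [this]; exact (ρ ⟨i, hi⟩).2
      have h1 : (β i : WithBot ℝ) = α i := by
        obtain ⟨a, ha⟩ := WithBot.ne_bot_iff_exists.1 hi
        simp [β, ← ha]
      have h2 : (β (σ i) : WithBot ℝ) = α (σ i) := by
        obtain ⟨a, ha⟩ := WithBot.ne_bot_iff_exists.1 hσi
        simp [β, ← ha]
      rw [h1, h2]
      exact hle i hi
  have hsum := sum_le_sum fun i (_ : i ∈ univ) => hβ i
  rw [sum_add_distrib, sum_add_distrib, Equiv.sum_comp σ fun i => (β i : WithBot ℝ)] at hsum
  rw [sum_coe_withBot, WithBot.add_le_add_iff_left WithBot.coe_ne_bot] at hsum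
  exact (h.lt σ hσ).not_ge hsum

/-! ### Independence implies dominance. -/

/-- A permutation of nonnegative total weight carries a potential along its nonnegative cycles. -/
theorem exists_potential {ι : Type*} [Fintype ι] {σ : Equiv.Perm ι} (hσ : σ ≠ 1) {w : ι → ℝ}
    (hfix : ∀ i, σ i = i → w i = 0) (hw : 0 ≤ ∑ i, w i) :
    ∃ α : ι → WithBot ℝ, (∃ i, α i ≠ ⊥) ∧
      ∀ i, α i ≠ ⊥ → σ i ≠ i ∧ α i ≤ α (σ i) + (w i : WithBot ℝ) := by
  classical
  let S (k : ℕ) (i : ι) : ℝ := ∑ t ∈ range k, w ((σ ^ t) i)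
  have hS (k : ℕ) (i : ι) : S (k + 1) i = S k (σ i) + w i := by
    simp [S, sum_range_succ', pow_succ]
  -- `L` is a multiple of every cycle length, so `S L` is constant on cycles and has the sign of the
  -- cycle's weight.
  let L := orderOf σ
  have hL : 0 < L := orderOf_pos σ
  have hSσ (i : ι) : S L (σ i) = S L i := by
    have h1 := hS L i
    have h2 : S (L + 1) i = S L i + w i := by
      simp [S, sum_range_succ, L, pow_orderOf_eq_one]
    linarith
  have hne : (range L).Nonempty := nonempty_range_iff.2 hL.ne'
  -- The potential is the largest partial sum along the orbit, on nontrivial cycles of nonnegative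
  -- weight.
  refine ⟨fun i => if σ i ≠ i ∧ 0 ≤ S L i then
    (((range L).sup' hne fun k => S k i : ℝ) : WithBot ℝ) else ⊥, ?_, fun i hi => ?_⟩
  · by_contra! hall
    have hneg (i : ι) (hi : σ i ≠ i) : S L i < 0 := by
      by_contra! h0
      have := hall i
      rw [if_pos ⟨hi, h0⟩] at this
      exact WithBot.coe_ne_bot this
    have hzero (i : ι) (hi : σ i = i) : S L i = 0 := by
      refine sum_eq_zero fun t _ => ?_
      have : (σ ^ t) i = i := Function.IsFixedPt.perm_pow hi t
      rw [this, hfix i hi]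
    have htot : ∑ i, S L i = L * ∑ i, w i := by
      rw [sum_comm]
      simp [Equiv.sum_comp]
    obtain ⟨i, hi⟩ : ∃ i, σ i ≠ i := by
      by_contra! h
      exact hσ (Equiv.ext h)
    have : ∑ i, S L i < ∑ i : ι, (0 : ℝ) := by
      refine sum_lt_sum (fun k _ => ?_) ⟨i, mem_univ i, hneg i hi⟩
      by_cases hk : σ k = k
      · exact (hzero k hk).le
      · exact (hneg k hk).le
    rw [htot, sum_const_zero] at this
    exact this.not_ge (by positivity)
  · have hc : σ i ≠ i ∧ 0 ≤ S L i := by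
      by_contra h
      exact hi (if_neg h)
    have hc' : σ (σ i) ≠ σ i ∧ 0 ≤ S L (σ i) :=
      ⟨fun h => hc.1 (σ.injective h), (hSσ i).symm ▸ hc.2⟩
    refine ⟨hc.1, ?_⟩
    simp only [if_pos hc, if_pos hc']
    norm_cast
    refine sup'_le _ _ fun k hk => ?_
    rcases k with _ | k
    -- The empty partial sum is bounded by the full one, `S L i ≥ 0`, whose tail from `σ i` has
    -- length `L - 1`.
    · obtain ⟨l, hl⟩ := Nat.exists_eq_succ_of_ne_zero hL.ne'
      have h1 := le_sup' (fun k => S k (σ i)) (show l ∈ range L by simp [hl])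
      have h2 := hS l i
      have h3 := hc.2
      simp only [Nat.succ_eq_add_one] at hl
      rw [hl, h2] at h3
      simp only [S, range_zero, sum_empty] at h1 ⊢
      linarith
    · have h1 := le_sup' (fun k => S k (σ i)) (show k ∈ range L by
        simp only [mem_range] at hk ⊢; omega)
      have h2 := hS k i
      linarith

/-- If no assignment through `R` is strictly dominant, some nontrivial vector balances all of `R`. -/
theorem exists_balances {ι κ : Type*} [Fintype ι] [Nonempty ι] (m : ι → κ → WithBot ℝ)
    (R : Finset (ι × κ)) (hR : ∀ p ∈ R, m p.1 p.2 ≠ ⊥)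
    (hφ : ∀ φ : ι → κ, Function.Injective φ → (∀ i, (i, φ i) ∈ R) →
      ∃ σ : Equiv.Perm ι, σ ≠ 1 ∧ ∑ i, m i (φ i) ≤ ∑ i, m (σ i) (φ i)) :
    ∃ α : ι → WithBot ℝ, (∃ i, α i ≠ ⊥) ∧ ∀ p ∈ R, α p.1 ≠ ⊥ → Balances m α p.1 p.2 := by
  classical
  induction R using Finset.strongInduction with
  | H R ih =>
  by_cases hdup : ∃ i j₁ j₂, (i, j₁) ∈ R ∧ (i, j₂) ∈ R ∧ j₁ ≠ j₂
  · obtain ⟨i, j₁, j₂, h₁, h₂, hne⟩ := hdup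
    -- Each solution may miss one of the two entries of row `i`; rescaled to agree at `i`, their
    -- maximum balances both.
    have step (j : κ) (hj : (i, j) ∈ R) := ih (R.erase (i, j)) (erase_ssubset hj)
      (fun p hp => hR p (mem_of_mem_erase hp))
      (fun φ hi h => hφ φ hi fun i => mem_of_mem_erase (h i))
    obtain ⟨α, hα, hbα⟩ := step j₁ h₁
    obtain ⟨β, hβ, hbβ⟩ := step j₂ h₂
    have hbot (j : κ) (γ : ι → WithBot ℝ) (hγ : γ i = ⊥)
        (hb : ∀ p ∈ R.erase (i, j), γ p.1 ≠ ⊥ → Balances m γ p.1 p.2) :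
        ∀ p ∈ R, γ p.1 ≠ ⊥ → Balances m γ p.1 p.2 := fun p hp hne =>
      hb p (mem_erase.2 ⟨fun h => hne (by rw [h, hγ]), hp⟩) hne
    by_cases hαi : α i = ⊥
    · exact ⟨α, hα, hbot j₁ α hαi hbα⟩
    by_cases hβi : β i = ⊥
    · exact ⟨β, hβ, hbot j₂ β hβi hbβ⟩
    have hadd {x y c : WithBot ℝ} (z z' : WithBot ℝ) (h : x + z ≤ y + z') :
        x + c + z ≤ y + c + z' := by
      rw [add_right_comm, add_right_comm y]
      exact add_le_add_left h c
    refine ⟨fun k => max (α k + β i) (β k + α i), ⟨i, ?_⟩, fun p hp hpne => ?_⟩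
    · simp [hαi, hβi]
    have left (h : p ∈ R.erase (i, j₁)) (hle : β p.1 + α i ≤ α p.1 + β i) :
        Balances m (fun k => max (α k + β i) (β k + α i)) p.1 p.2 := by
      have hp' : α p.1 ≠ ⊥ := by
        intro h0
        simp only [h0, WithBot.bot_add, le_bot_iff] at hle
        simp [h0, hle] at hpne
      obtain ⟨k, hk, hb⟩ := hbα p h hp'
      refine ⟨k, hk, ?_⟩
      simp only [max_eq_left hle]
      exact (hadd _ _ hb).trans (add_le_add_left (le_max_left _ _) _)
    have right (h : p ∈ R.erase (i, j₂)) (hle : α p.1 + β i ≤ β p.1 + α i) :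
        Balances m (fun k => max (α k + β i) (β k + α i)) p.1 p.2 := by
      have hp' : β p.1 ≠ ⊥ := by
        intro h0
        simp only [h0, WithBot.bot_add, le_bot_iff] at hle
        simp [h0, hle] at hpne
      obtain ⟨k, hk, hb⟩ := hbβ p h hp'
      refine ⟨k, hk, ?_⟩
      simp only [max_eq_right hle]
      exact (hadd _ _ hb).trans (add_le_add_left (le_max_right _ _) _)
    -- In row `i` both solutions attain the maximum, so the one that balances the entry can be used;
    -- elsewhere, use the larger.
    by_cases hpi : p.1 = i
    · have heq : α p.1 + β i = β p.1 + α i := by rw [hpi, add_comm]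
      by_cases hp1 : p = (i, j₁)
      · exact right (mem_erase.2 ⟨by rw [hp1]; simpa using hne, hp⟩) heq.le
      · exact left (mem_erase.2 ⟨hp1, hp⟩) heq.ge
    · have hp_ne (j : κ) : p ∈ R.erase (i, j) := mem_erase.2 ⟨fun h => hpi (by rw [h]), hp⟩
      exact (le_total _ _).elim (left (hp_ne j₁)) (right (hp_ne j₂))
  by_cases hdom : ∀ i, ∃ j, (i, j) ∈ R
  · choose φ hφR using hdom
    have huniq (p : ι × κ) (hp : p ∈ R) : p.2 = φ p.1 := by
      by_contra hne
      exact hdup ⟨p.1, p.2, φ p.1, hp, hφR p.1, hne⟩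
    by_cases hinj : Function.Injective φ
    · obtain ⟨σ, hσ, hle⟩ := hφ φ hinj hφR
      have ha (i : ι) : ∃ a : ℝ, (a : WithBot ℝ) = m i (φ i) :=
        WithBot.ne_bot_iff_exists.1 (hR _ (hφR i))
      choose a ha using ha
      have hb (i : ι) : ∃ b : ℝ, (b : WithBot ℝ) = m (σ i) (φ i) := by
        refine WithBot.ne_bot_iff_exists.1 fun h => ?_
        have : ∑ i, m (σ i) (φ i) = ⊥ := WithBot.sum_eq_bot_iff.2 ⟨i, mem_univ i, h⟩
        simp only [this, ← ha, sum_coe_withBot, le_bot_iff, WithBot.coe_ne_bot] at hle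
      choose b hb using hb
      simp only [← ha, ← hb, sum_coe_withBot, WithBot.coe_le_coe] at hle
      obtain ⟨α, hα, hpot⟩ := exists_potential (w := fun i => b i - a i) hσ
        (fun i hi => by
          have := hb i
          rw [hi, ← ha, WithBot.coe_inj] at this
          simp [this])
        (by rw [sum_sub_distrib]; linarith)
      refine ⟨α, hα, fun p hp hne => ?_⟩
      obtain ⟨hne', hle'⟩ := hpot p.1 hne
      refine ⟨σ p.1, hne', ?_⟩
      rw [huniq p hp, ← ha, ← hb]
      refine (add_le_add_left hle' _).trans ?_
      rw [add_assoc, ← WithBot.coe_add, sub_add_cancel]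
    · simp only [Function.Injective, not_forall] at hinj
      obtain ⟨i, k, hik, hne⟩ := hinj
      -- Two rows share their only column in `R`; crossing over their entries as coefficients makes
      -- the two terms equal.
      refine ⟨fun l => if l = i then m k (φ i) else if l = k then m i (φ i) else ⊥, ⟨i, ?_⟩,
        fun p hp hpne => ?_⟩
      · simpa [hik] using hR _ (hφR k)
      · by_cases h1 : p.1 = i
        · refine ⟨k, by rw [h1]; exact Ne.symm hne, ?_⟩
          simp [huniq p hp, h1, Ne.symm hne, add_comm]
        · by_cases h2 : p.1 = k
          · refine ⟨i, by rw [h2]; exact hne, ?_⟩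
            simp [huniq p hp, h2, Ne.symm hne, ← hik, add_comm]
          · simp [h1, h2] at hpne
  · push Not at hdom
    obtain ⟨i, hi⟩ := hdom
    -- A row without entries in `R` has nothing to balance, so it alone can form the support.
    refine ⟨fun k => if k = i then 0 else ⊥, ⟨i, by simp⟩, fun p hp hne => ?_⟩
    have : p.1 = i := by
      by_contra h
      simp [h] at hne
    exact absurd (this ▸ hp) (hi p.2)

theorem exists_isDominant {ι : Type} [Fintype ι] {n : ℕ} {v : ι → Fin n → ExtTrop}
    (h : TropIndependent v) : ∃ φ, IsDominant v φ := by
  classical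
  by_contra! hno
  rcases isEmpty_or_nonempty ι with hι | hι
  · exact hno isEmptyElim ⟨Function.injective_of_subsingleton _, isEmptyElim,
      fun σ hσ => absurd (Subsingleton.elim σ 1) hσ⟩
  obtain ⟨α, hα, hb⟩ := exists_balances (fun i j => magnitude (v i j))
    (univ.filter fun p : ι × Fin n => IsReal (v p.1 p.2))
    (fun p hp => (mem_filter.1 hp).2.magnitude_ne_bot)
    (fun φ hinj hφ => by
      by_contra! hlt
      exact hno φ ⟨hinj, fun i => (mem_filter.1 (hφ i)).2, hlt⟩)
  exact h ((tropDependent_iff v).2 ⟨α, hα, fun i j hi hr => hb (i, j) (by simpa using hr) hi⟩)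

theorem tropIndependent_iff_exists_isDominant {ι : Type} [Fintype ι] {n : ℕ}
    {v : ι → Fin n → ExtTrop} : TropIndependent v ↔ ∃ φ, IsDominant v φ :=
  ⟨exists_isDominant, fun ⟨_, h⟩ => h.tropIndependent⟩

/-! ### From independent rows to minors and rank. -/

theorem tropIndependent_comp_equiv {ι κ : Type} [Fintype ι] [Fintype κ] {n : ℕ} (e : ι ≃ κ)
    (v : κ → Fin n → ExtTrop) : TropIndependent (fun i => v (e i)) ↔ TropIndependent v := by
  refine not_congr ⟨fun ⟨α, hα, ⟨i, hi⟩, h⟩ => ?_, fun ⟨α, hα, ⟨i, hi⟩, h⟩ => ?_⟩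
  · refine ⟨fun k => α (e.symm k), fun k => hα _, ⟨e i, by simpa using hi⟩, ?_⟩
    rw [← Equiv.sum_comp e]
    simpa using h
  · refine ⟨fun k => α (e k), fun k => hα _, ⟨e.symm i, by simpa using hi⟩, ?_⟩
    rwa [Equiv.sum_comp e fun k => α k • v k]

theorem hasNonsingularMinor_iff_exists_finset {m n : ℕ} (A : Matrix (Fin m) (Fin n) ExtTrop)
    (s : ℕ) : HasNonsingularMinor A s ↔
      ∃ S : Finset (Fin m), TropIndependent (fun i : S => A i) ∧ S.card = s := by
  rw [hasNonsingularMinor_iff]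
  simp only [← tropIndependent_iff_exists_isDominant]
  constructor
  · rintro ⟨r, h⟩
    have hcard : (univ.map r.toEmbedding).card = s := by simp
    let e : Fin s ≃ (univ.map r.toEmbedding : Finset (Fin m)) :=
      Equiv.ofBijective (fun i => ⟨r i, by simp⟩) ⟨fun i k h => by simpa using h, fun ⟨k, hk⟩ => by
        simpa [Subtype.ext_iff] using hk⟩
    exact ⟨_, (tropIndependent_comp_equiv e fun i => A i).1 h, hcard⟩
  · rintro ⟨S, h, hS⟩
    exact ⟨S.orderEmbOfFin hS,
      (tropIndependent_comp_equiv (S.orderIsoOfFin hS).toEquiv fun i => A i).2 h⟩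

theorem isGreatest_tropRank {m n : ℕ} (A : Matrix (Fin m) (Fin n) ExtTrop) :
    IsGreatest {s : ℕ | HasNonsingularMinor A s} (tropRank A) := by
  classical
  simp only [hasNonsingularMinor_iff_exists_finset]
  have hempty : TropIndependent fun i : (∅ : Finset (Fin m)) => A i :=
    fun ⟨_, _, ⟨i, _⟩, _⟩ => absurd i.2 (notMem_empty _)
  constructor
  · obtain ⟨S, hS, hsup⟩ := exists_mem_eq_sup
      (univ.filter fun S : Finset (Fin m) => TropIndependent fun i : S => A i)
      ⟨∅, mem_filter.2 ⟨mem_univ _, hempty⟩⟩ card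
    refine ⟨S, (mem_filter.1 hS).2, ?_⟩
    rw [← hsup, tropRank]
  · rintro s ⟨S, hS, rfl⟩
    exact le_sup (f := card) (mem_filter.2 ⟨mem_univ _, hS⟩)

end ExtTrop

theorem mainTheorem5 (m n : ℕ) (A : Matrix (Fin m) (Fin n) ExtTrop) (k : ℕ) :
    ExtTrop.tropRank A = k ↔ IsGreatest {s : ℕ | ExtTrop.HasNonsingularMinor A s} k :=
  ⟨fun h => h ▸ ExtTrop.isGreatest_tropRank A,
    fun h => (ExtTrop.isGreatest_tropRank A).unique h⟩
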